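/- **Theorem (Random Universal Approximation Theorem).** Let $n\in\mathbb{N}$, let $I_n:=[-1,1]^n\subset\mathbb{R}^n$ and let $f\in C^1(I_n,\mathbb{R})$. Let $\sigma\in C^1(\mathbb{R})$ be $1$-finite, that is, $0<\int_{\mathbb{R}}|\sigma'(x)|\,dx<\infty$. Let $(v_j)_{j\in\mathbb{N}}$ and $(b_j)_{j\in\mathbb{N}}$ be sequences of $\mathbb{R}^n$-valued and $\mathbb{R}$-valued random variables on a common probability space such that the pairs $(v_j,b_j)$, $j\in\mathbb{N}$, are independent and identically distributed and their common law has full support in $\mathbb{R}^n\times\mathbb{R}$ (every non-empty open subset of $\mathbb{R}^n\times\mathbb{R}$ has positive probability). Then for every $\alpha\in(0,1)$ and every $\epsilon>0$ there is a positive integer $N$ such that, with probability greater than $\alpha$, there exist real numbers $w_1,\dots,w_N$ for which the random neural network $g:I_n\to\mathbb{R}$, $$g(x)=\sum_{j=1}^{N}w_j\,\sigma(v_j^{\top}x+b_j),$$ satisfies $\|f-g\|_{C^1}<\epsilon$. Here $\|h\|_{C^1}:=\sup_{x\in I_n}|h(x)|+\sup_{x\in I_n}\|Dh(x)\|$, where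 $\|Dh(x)\|$ is the operator norm with respect to the Euclidean norm on $\mathbb{R}^n$. -/

import Mathlib

open MeasureTheory ProbabilityTheory
open scoped ENNReal

/-- A scalar function `σ` is `ℓ`-finite if it is of class `C^ℓ` and its `ℓ`-th derivative
satisfies `0 < ∫ |σ^(ℓ)(x)| dx < ∞` (Lebesgue integral over the whole line). -/
def IsFiniteOfOrder (l : ℕ) (σ : ℝ → ℝ) : Prop :=
  ContDiff ℝ l σ ∧ 0 < ∫⁻ x : ℝ, ‖iteratedDeriv l σ x‖ₑ ∧ ∫⁻ x : ℝ, ‖iteratedDeriv l σ x‖ₑ < ∞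

/-- The hypercube `I_n = [-1, 1]^n` in Euclidean space. -/
def hypercube (n : ℕ) : Set (EuclideanSpace ℝ (Fin n)) :=
  {x | ∀ i, x i ∈ Set.Icc (-1 : ℝ) 1}

/-- The `C^1` norm `sup_{x ∈ I_n} |h x| + sup_{x ∈ I_n} ‖Dh x‖` of a function on the hypercube
`I_n`. The derivative is taken relative to `I_n`, and `‖Dh x‖` is the operator norm for the
Euclidean norm. Suprema are taken in `[0, ∞]`, so they never have a default value. -/
noncomputable def c1Norm {n : ℕ} (h : EuclideanSpace ℝ (Fin n) → ℝ) : ℝ≥0∞ :=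
  (⨆ x ∈ hypercube n, ‖h x‖ₑ) + ⨆ x ∈ hypercube n, ‖fderivWithin ℝ h (hypercube n) x‖ₑ

/-- The single-layer network `x ↦ ∑_{j < N} w_j σ(v_jᵀ x + b_j)`. -/
noncomputable def network {n N : ℕ} (σ : ℝ → ℝ) (v : Fin N → EuclideanSpace ℝ (Fin n))
    (b w : Fin N → ℝ) (x : EuclideanSpace ℝ (Fin n)) : ℝ :=
  ∑ j, w j * σ (inner ℝ (v j) x + b j)

open Filter Topology FourierTransform

/-! It suffices to find one deterministic network close to f in C^1. Small changes of its neurons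
are harmless on the compact cube, full support gives each neighbourhood of a neuron positive
probability, and an i.i.d. sequence soon visits all of these finitely many neighbourhoods.

For the deterministic part one approximates gradients. A neuron has gradient σ'(⟨a, x⟩ + b) a, where
σ' is integrable and nonzero, so its Fourier transform is nonzero at some w ≠ 0. Integrating over
the bias b against exp(-2πiwb) turns σ' into a plane wave (`ridge_fourierExp_mem_ridgeSpan`). By
Fourier inversion the gradient of a Schwartz function is a superposition of plane-wave fields
exp(2πi⟨ξ, x⟩) ξ (`SchwartzMap.exists_fderiv_near`). Dilation, cutoff and mollification reduce f to
this case. Values follow from gradients by the mean value inequality, once a constant neuron has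
matched them at 0 (`exists_network_near`). -/

/-- A Bochner integral of a function with values in a closed subspace lies in that subspace. -/
theorem Submodule.integral_mem_of_isClosed {X B : Type*} [MeasurableSpace X] {μ : Measure X}
    [NormedAddCommGroup B] [NormedSpace ℂ B] [CompleteSpace B] (V : Submodule ℂ B)
    (hV : IsClosed (V : Set B)) {F : X → B} (hF : Integrable F μ) (h : ∀ x, F x ∈ V) :
    ∫ x, F x ∂μ ∈ V := by
  have : IsClosed (V : Set B) := hV
  -- The continuous quotient map by V commutes with the integral and kills the integrand.
  have h1 := V.mkQL.integral_comp_comm hF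
  have h2 : ∀ x, V.mkQL (F x) = 0 := fun x => (Submodule.Quotient.mk_eq_zero V).2 (h x)
  simp only [h2, integral_zero] at h1
  exact (Submodule.Quotient.mk_eq_zero V).1 h1.symm

/-! ### Plane waves from ridge fields -/

section Ridge

variable {E F : Type*} [NormedAddCommGroup E] [InnerProductSpace ℝ E]
  [NormedAddCommGroup F] [NormedSpace ℂ F]

/-- The `F`-valued field `x ↦ s(⟨a, x⟩ + b) T a` on `K`. -/
noncomputable def ridge (K : Set E) (T : E →L[ℝ] F) (s : C(ℝ, ℂ)) (p : E × ℝ) : C(K, F) where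
  toFun x := s (inner ℝ p.1 (x : E) + p.2) • T p.1
  continuous_toFun := by fun_prop

theorem ridge_apply (K : Set E) (T : E →L[ℝ] F) (s : C(ℝ, ℂ)) (p : E × ℝ) (x : K) :
    ridge K T s p x = s (inner ℝ p.1 (x : E) + p.2) • T p.1 := rfl

theorem continuous_ridge (K : Set E) (T : E →L[ℝ] F) (s : C(ℝ, ℂ)) : Continuous (ridge K T s) := by
  let c : C((E × ℝ) × K, F) :=
    ⟨fun q => s (inner ℝ q.1.1 (q.2 : E) + q.1.2) • T q.1.1, by fun_prop⟩
  exact c.curry.continuous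

/-- The closed complex span of the ridge fields with profile `s`. -/
noncomputable def ridgeSpan (K : Set E) (T : E →L[ℝ] F) (s : C(ℝ, ℂ)) : Submodule ℂ C(K, F) :=
  (Submodule.span ℂ (Set.range (ridge K T s))).topologicalClosure

theorem ridge_mem_ridgeSpan (K : Set E) (T : E →L[ℝ] F) (s : C(ℝ, ℂ)) (p : E × ℝ) :
    ridge K T s p ∈ ridgeSpan K T s :=
  Submodule.le_topologicalClosure _ (Submodule.subset_span ⟨p, rfl⟩)

theorem isClosed_ridgeSpan (K : Set E) (T : E →L[ℝ] F) (s : C(ℝ, ℂ)) :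
    IsClosed (ridgeSpan K T s : Set C(K, F)) :=
  Submodule.isClosed_topologicalClosure _

/-- The complex exponential `t ↦ exp(2πit)`. -/
noncomputable def fourierExp : C(ℝ, ℂ) where
  toFun t := Complex.exp (↑(2 * Real.pi * t) * Complex.I)
  continuous_toFun := by fun_prop

theorem fourierExp_apply (t : ℝ) :
    fourierExp t = Complex.exp (↑(2 * Real.pi * t) * Complex.I) := rfl

theorem fourierExp_add (s t : ℝ) : fourierExp (s + t) = fourierExp s * fourierExp t := by
  simp only [fourierExp_apply, ← Complex.exp_add]
  congr 1
  push_cast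
  ring

theorem norm_fourierExp (t : ℝ) : ‖fourierExp t‖ = 1 := Complex.norm_exp_ofReal_mul_I _

theorem continuous_fourier_of_integrable {s : ℝ → ℂ} (hs : Integrable s) : Continuous (𝓕 s) :=
  VectorFourier.fourierIntegral_continuous Real.continuous_fourierChar
    (by fun_prop) hs

/-- A non-zero continuous integrable function has a non-zero Fourier coefficient at some non-zero
frequency. -/
theorem exists_fourier_ne_zero (s : C(ℝ, ℂ)) (hs : Integrable s) (h0 : s ≠ 0) :
    ∃ w : ℝ, w ≠ 0 ∧ 𝓕 (s : ℝ → ℂ) w ≠ 0 := by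
  by_contra! h
  -- The transform is continuous, so vanishing off 0 forces vanishing at 0; inversion then gives s =
  -- 0.
  have hz : 𝓕 (s : ℝ → ℂ) = 0 := by
    refine Continuous.ext_on (dense_compl_singleton (0 : ℝ)) (continuous_fourier_of_integrable hs)
      continuous_const fun w hw => h w hw
  have h1 := s.continuous.fourierInv_fourier_eq hs (by rw [hz]; exact integrable_zero _ _ _)
  apply h0
  ext x
  rw [← h1, hz, Real.fourierInv_eq']
  simp

/-- Truncated convolution integrals against an exponential converge locally uniformly. -/
theorem eventually_norm_intervalIntegral_sub_le (s : C(ℝ, ℂ)) (hs : Integrable s) (w R : ℝ)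
    {ε : ℝ} (hε : 0 < ε) :
    ∀ᶠ M : ℝ in atTop, ∀ t : ℝ, |t| ≤ R →
      ‖(∫ b in (-M)..M, fourierExp (-(w * b)) * s (t + b))
        - fourierExp (w * t) * 𝓕 (s : ℝ → ℂ) w‖ ≤ ε := by
  set g : ℝ → ℂ := fun u => fourierExp (-(w * u)) * s u with hg
  have hgi : Integrable g :=
    hs.bdd_mul (c := 1) (by fun_prop) (ae_of_all _ fun u => (norm_fourierExp _).le)
  have hF : 𝓕 (s : ℝ → ℂ) w = ∫ u, g u := by
    rw [Real.fourier_real_eq_integral_exp_smul]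
    refine integral_congr_ae (ae_of_all _ fun u => ?_)
    simp only [hg, fourierExp_apply, smul_eq_mul]
    congr 3
    push_cast
    ring
  have hlim : Tendsto (fun p : ℝ × ℝ => ∫ u in p.1..p.2, g u) (atBot ×ˢ atTop)
      (𝓝 (∫ u, g u)) :=
    intervalIntegral_tendsto_integral hgi tendsto_fst tendsto_snd
  have hev := (Metric.tendsto_nhds.1 hlim) ε hε
  obtain ⟨pa, ha, pb, hb, hab⟩ := Filter.eventually_prod_iff.1 hev
  obtain ⟨A, hA⟩ := eventually_atBot.1 ha
  obtain ⟨B, hB⟩ := eventually_atTop.1 hb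
  -- Substituting u = t + b moves the window to [t - M, t + M]; these bounds put its ends beyond A
  -- and B for every |t| ≤ R.
  filter_upwards [eventually_ge_atTop (B + R), eventually_ge_atTop (R - A)] with M hM1 hM2 t ht
  have ht' := abs_le.1 ht
  have h1 := hab (hA (-M + t) (by linarith)) (hB (M + t) (by linarith))
  have h2 : ∫ b in (-M)..M, fourierExp (-(w * b)) * s (t + b)
      = fourierExp (w * t) * ∫ u in (-M + t)..(M + t), g u := by
    rw [← intervalIntegral.integral_comp_add_right (fun u => g u) t,
      ← intervalIntegral.integral_const_mul]
    refine intervalIntegral.integral_congr fun b _ => ?_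
    simp only [hg]
    rw [← mul_assoc, ← fourierExp_add, add_comm t b]
    congr 2
    ring
  rw [h2, hF, ← mul_sub, norm_mul, norm_fourierExp, one_mul]
  simpa [dist_eq_norm] using h1.le

variable {K : Set E} [CompactSpace K] [CompleteSpace F] {T : E →L[ℝ] F}

/-- With a' = a/w, integrating s(⟨a', x⟩ + b) over b against exp(-2πiwb) gives 𝓕 s(w) exp(2πi⟨a,
x⟩), uniformly on K for truncated integrals. Since T a' = w⁻¹ T a, the limit is a nonzero multiple
of the plane-wave field. -/
theorem ridge_fourierExp_mem_ridgeSpan (s : C(ℝ, ℂ)) (hs : Integrable s) (h0 : s ≠ 0) (a : E) :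
    ridge K T fourierExp (a, 0) ∈ ridgeSpan K T s := by
  obtain ⟨w, hw, hc⟩ := exists_fourier_ne_zero s hs h0
  set c := 𝓕 (s : ℝ → ℂ) w
  set a' := w⁻¹ • a with ha'
  have hcont : Continuous fun b : ℝ => fourierExp (-(w * b)) • ridge K T s (a', b) :=
    (by fun_prop : Continuous fun b : ℝ => fourierExp (-(w * b))).smul
      ((continuous_ridge K T s).comp (by fun_prop))
  have hmem : ∀ M : ℝ, ∫ b in (-M)..M, fourierExp (-(w * b)) • ridge K T s (a', b)
      ∈ ridgeSpan K T s := by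
    intro M
    rw [intervalIntegral]
    refine Submodule.sub_mem _ ?_ ?_ <;>
    refine Submodule.integral_mem_of_isClosed _ (isClosed_ridgeSpan K T s) ?_ fun b =>
      Submodule.smul_mem _ _ (ridge_mem_ridgeSpan K T s _)
    · exact (hcont.intervalIntegrable (-M) M).1
    · exact (hcont.intervalIntegrable (-M) M).2
  obtain ⟨R, hR⟩ := ((isCompact_iff_compactSpace.2 ‹CompactSpace K›).image
    (continuous_const.inner continuous_id : Continuous fun x : E => inner ℝ a' x)).isBounded
    |>.exists_norm_le
  have hlim : Tendsto (fun M : ℝ => ∫ b in (-M)..M, fourierExp (-(w * b)) • ridge K T s (a', b))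
      atTop (𝓝 ((c * (w⁻¹ : ℝ)) • ridge K T fourierExp (a, 0))) := by
    rw [Metric.tendsto_nhds]
    intro ε hε
    have hδ : 0 < ε / 2 / (‖T a'‖ + 1) := by positivity
    filter_upwards [eventually_norm_intervalIntegral_sub_le s hs w R hδ] with M hM
    refine lt_of_le_of_lt ?_ (half_lt_self hε)
    rw [dist_eq_norm, ContinuousMap.norm_le _ (by positivity)]
    intro x
    have hx := hM (inner ℝ a' (x : E)) (hR _ ⟨x, x.2, rfl⟩)
    have heq : (∫ b in (-M)..M, fourierExp (-(w * b)) • ridge K T s (a', b)) x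
        = (∫ b in (-M)..M, fourierExp (-(w * b)) * s (inner ℝ a' (x : E) + b)) • T a' := by
      have h1 := (ContinuousMap.evalCLM ℂ x : C(K, F) →L[ℂ] _).intervalIntegral_comp_comm
        (hcont.intervalIntegrable (μ := volume) (-M) M)
      simp only [ContinuousMap.evalCLM_apply] at h1
      rw [← h1, ← intervalIntegral.integral_smul_const]
      refine intervalIntegral.integral_congr fun b _ => ?_
      simp [ridge_apply, smul_smul]
    have heq2 : ((c * (w⁻¹ : ℝ)) • ridge K T fourierExp (a, 0)) x
        = (fourierExp (w * inner ℝ a' (x : E)) * c) • T a' := by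
      have : w * inner ℝ a' (x : E) = inner ℝ a (x : E) := by
        rw [ha', real_inner_smul_left, ← mul_assoc, mul_inv_cancel₀ hw, one_mul]
      rw [this, ha', map_smul, ← Complex.coe_smul, smul_smul, ContinuousMap.smul_apply, ridge_apply,
        smul_smul, add_zero]
      congr 1
      ring
    rw [ContinuousMap.sub_apply, heq, heq2, ← sub_smul, norm_smul]
    calc _ ≤ ε / 2 / (‖T a'‖ + 1) * (‖T a'‖ + 1) := by
          gcongr
          linarith
      _ = ε / 2 := by field_simp
  have h := (isClosed_ridgeSpan K T s).mem_of_tendsto hlim (Eventually.of_forall hmem)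
  have hne : c * ((w⁻¹ : ℝ) : ℂ) ≠ 0 := mul_ne_zero hc (by simpa using hw)
  exact (Submodule.smul_mem_iff _ hne).1 h

/-- Fields with an absolutely convergent Fourier representation whose coefficients are multiples of
`T ξ` are uniform limits on `K` of linear combinations of ridge fields. -/
theorem exists_ridge_sum_near [MeasurableSpace E] [OpensMeasurableSpace E]
    [SecondCountableTopology E] {μ : Measure E}
    (s : C(ℝ, ℂ)) (hs : Integrable s) (h0 : s ≠ 0) (g : E → ℂ) (hg : Continuous g)
    (hgT : Integrable (fun ξ => g ξ • T ξ) μ) {ε : ℝ} (hε : 0 < ε) :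
    ∃ (S : Finset (E × ℝ)) (c : E × ℝ → ℂ), ∀ x ∈ K,
      ‖(∫ ξ, fourierExp (inner ℝ ξ x) • g ξ • T ξ ∂μ)
        - ∑ p ∈ S, c p • s (inner ℝ p.1 x + p.2) • T p.1‖ < ε := by
  have hcont : Continuous fun ξ : E => g ξ • ridge K T fourierExp (ξ, 0) :=
    hg.smul ((continuous_ridge K T _).comp (by fun_prop))
  have hval : ∀ (ξ : E) (x : K), (g ξ • ridge K T fourierExp (ξ, 0)) x =
      fourierExp (inner ℝ ξ (x : E)) • g ξ • T ξ := by
    intro ξ x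
    rw [ContinuousMap.smul_apply, ridge_apply, add_zero, smul_comm]
  have hint : Integrable (fun ξ : E => g ξ • ridge K T fourierExp (ξ, 0)) μ := by
    refine hgT.norm.mono' hcont.aestronglyMeasurable (ae_of_all _ fun ξ => ?_)
    rw [ContinuousMap.norm_le _ (norm_nonneg _)]
    intro x
    rw [hval, norm_smul, norm_fourierExp, one_mul]
  have hmem := Submodule.integral_mem_of_isClosed _ (isClosed_ridgeSpan K T s) hint fun ξ =>
    Submodule.smul_mem _ _ (ridge_fourierExp_mem_ridgeSpan s hs h0 ξ)
  obtain ⟨q, hq, hd⟩ := Metric.mem_closure_iff.1 hmem ε hε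
  obtain ⟨c, rfl⟩ := Finsupp.mem_span_range_iff_exists_finsupp.1 hq
  refine ⟨c.support, c, fun x hx => ?_⟩
  have := (ContinuousMap.dist_apply_le_dist (⟨x, hx⟩ : K)).trans_lt hd
  rw [ContinuousMap.integral_apply hint, dist_eq_norm, Finsupp.sum, ContinuousMap.sum_apply] at this
  simp only [hval] at this
  exact this

end Ridge

/-! ### Gradients of Schwartz functions by Fourier inversion -/

section Schwartz

/-- The embedding of `E` into its complexified dual given by the inner product. -/
noncomputable def complexInnerSL (E : Type*) [NormedAddCommGroup E] [InnerProductSpace ℝ E] :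
    E →L[ℝ] E →L[ℝ] ℂ :=
  (ContinuousLinearMap.compL ℝ E ℝ ℂ Complex.ofRealCLM).comp (innerSL ℝ)

theorem complexInnerSL_apply {E : Type*} [NormedAddCommGroup E] [InnerProductSpace ℝ E] (a y : E) : complexInnerSL E a y = (inner ℝ a y : ℝ) := rfl

variable {E : Type*} [NormedAddCommGroup E] [InnerProductSpace ℝ E] [FiniteDimensional ℝ E]
  [MeasurableSpace E] [BorelSpace E]

/-- The derivative of a Schwartz function is a uniform limit on `K` of linear combinations of
ridge fields. -/
theorem SchwartzMap.exists_fderiv_near {K : Set E} (hK : IsCompact K)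
    (s : C(ℝ, ℂ)) (hs : Integrable s) (h0 : s ≠ 0) (F : SchwartzMap E ℂ) {ε : ℝ} (hε : 0 < ε) :
    ∃ (S : Finset (E × ℝ)) (c : E × ℝ → ℂ), ∀ x ∈ K,
      ‖fderiv ℝ F x - ∑ p ∈ S, c p • s (inner ℝ p.1 x + p.2) • complexInnerSL E p.1‖ < ε := by
  have := isCompact_iff_compactSpace.1 hK
  set D := SchwartzMap.fderivCLM ℝ E ℂ F with hD
  have hDx : ∀ x, D x = fderiv ℝ F x := fun x => rfl
  have hinv : 𝓕⁻ (𝓕 (D : E → E →L[ℝ] ℂ)) = D :=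
    D.continuous.fourierInv_fourier_eq D.integrable (𝓕 D).integrable
  have hFD : 𝓕 (D : E → E →L[ℝ] ℂ) = fun ξ => (2 * Real.pi * Complex.I * 𝓕 (F : E → ℂ) ξ) •
      complexInnerSL E ξ := by
    change 𝓕 (fderiv ℝ F) = _
    rw [Real.fourier_fderiv F.integrable F.differentiable D.integrable]
    ext ξ y
    simp [complexInnerSL_apply, innerSL_apply_apply ℝ]
    ring
  have hi : Integrable (𝓕 (D : E → E →L[ℝ] ℂ)) := (𝓕 D).integrable
  rw [hFD] at hi
  obtain ⟨S, c, h⟩ := exists_ridge_sum_near (K := K) (T := complexInnerSL E) s hs h0 _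
    (continuous_const.mul (𝓕 F).continuous) hi hε
  refine ⟨S, c, fun x hx => ?_⟩
  have h' := h x hx
  rw [← hDx, ← hinv, Real.fourierInv_eq', hFD]
  exact h'

end Schwartz

/-! ### From compactly supported C¹ functions to Schwartz functions -/

section Mollification

open scoped ContDiff

variable {E : Type*} [NormedAddCommGroup E] [InnerProductSpace ℝ E] [FiniteDimensional ℝ E]
  [MeasurableSpace E] [BorelSpace E]

/-- A compactly supported `C¹` function is approximated by Schwartz functions, uniformly with its
derivative. -/
theorem exists_schwartzMap_fderiv_near {h : E → ℂ} (hh : ContDiff ℝ 1 h)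
    (hc : HasCompactSupport h) {ε : ℝ} (hε : 0 < ε) :
    ∃ F : SchwartzMap E ℂ, ∀ x, ‖fderiv ℝ F x - fderiv ℝ h x‖ ≤ ε := by
  have hDc : Continuous (fderiv ℝ h) := hh.continuous_fderiv (by simp)
  have hu : UniformContinuous (fderiv ℝ h) :=
    (hc.fderiv ℝ).uniformContinuous_of_continuous hDc
  obtain ⟨η, hη, hη'⟩ := Metric.uniformContinuous_iff.1 hu ε hε
  -- The support radius is the modulus η, so averaging the derivative of h over it moves it by at
  -- most ε.
  let φ : ContDiffBump (0 : E) := ⟨η / 2, η, by positivity, by linarith⟩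
  set L : ℝ →L[ℝ] ℂ →L[ℝ] ℂ := ContinuousLinearMap.lsmul ℝ ℝ with hL
  set g : E → ℂ := convolution (φ.normed volume) h L volume with hg
  have hgs : ContDiff ℝ ∞ g :=
    φ.hasCompactSupport_normed.contDiff_convolution_left L φ.contDiff_normed
      hh.continuous.locallyIntegrable
  have hgc : HasCompactSupport g := φ.hasCompactSupport_normed.convolution L hc
  refine ⟨hgc.toSchwartzMap hgs, fun x => ?_⟩
  have hd : HasFDerivAt g
      (convolution (φ.normed volume) (fderiv ℝ h) (L.precompR E) volume x) x :=
    hc.hasFDerivAt_convolution_right L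
      (φ.continuous_normed.locallyIntegrable) hh x
  have hconv : convolution (φ.normed volume) (fderiv ℝ h) (L.precompR E) volume x =
      convolution (φ.normed volume) (fderiv ℝ h) (ContinuousLinearMap.lsmul ℝ ℝ) volume x := by
    unfold convolution
    refine integral_congr_ae (ae_of_all _ fun t => ?_)
    ext y
    simp [hL]
  change ‖fderiv ℝ g x - _‖ ≤ ε
  rw [hd.fderiv, hconv, ← dist_eq_norm]
  exact φ.dist_normed_convolution_le hDc.aestronglyMeasurable fun y hy => (hη' hy).le

end Mollification

/-! ### Extension beyond a convex body by dilation and cutoff -/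

section Extension

open scoped Manifold Pointwise

variable {E : Type*} [NormedAddCommGroup E] [InnerProductSpace ℝ E] [FiniteDimensional ℝ E]

/-- A `C¹` function on a compact convex body containing `0` in its interior is approximated, up to
an error in the derivative, by compactly supported `C¹` functions on the whole space. -/
theorem exists_contDiff_hasCompactSupport_fderiv_near {K : Set E} (hK : IsCompact K)
    (hKc : Convex ℝ K) (h0 : (0 : E) ∈ interior K) {f : E → ℝ} (hf : ContDiffOn ℝ 1 f K)
    {ε : ℝ} (hε : 0 < ε) :
    ∃ h : E → ℝ, ContDiff ℝ 1 h ∧ HasCompactSupport h ∧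
      ∀ x ∈ K, ‖fderivWithin ℝ f K x - fderiv ℝ h x‖ ≤ ε := by
  have hud : UniqueDiffOn ℝ K := uniqueDiffOn_convex hKc ⟨0, h0⟩
  have hD : ContinuousOn (fderivWithin ℝ f K) K := hf.continuousOn_fderivWithin hud (by simp)
  obtain ⟨C, hC⟩ := hK.exists_bound_of_continuousOn hD
  obtain ⟨R, hR⟩ := hK.isBounded.exists_norm_le
  have hR0 : 0 ≤ R := (norm_nonneg _).trans (hR 0 (interior_subset h0))
  have hC0 : 0 ≤ C := (norm_nonneg _).trans (hC 0 (interior_subset h0))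
  obtain ⟨η, hη, hη'⟩ := Metric.uniformContinuousOn_iff.1
    (hK.uniformContinuousOn_of_continuous hD) (ε / 2) (by positivity)
  -- The extension is a cutoff of f((1 - τ)x). The bound on τR keeps x and (1 - τ)x within η; the
  -- bound on τC absorbs the chain-rule factor 1 - τ.
  obtain ⟨τ, hτ0, hτ1, hτR, hτC⟩ : ∃ τ : ℝ, 0 < τ ∧ τ < 1 ∧ τ * R < η ∧ τ * C ≤ ε / 2 := by
    refine ⟨min (1 / 2) (min (η / (R + 1)) (ε / 2 / (C + 1))), by positivity, ?_, ?_, ?_⟩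
    · exact (min_le_left _ _).trans_lt (by norm_num)
    · calc _ ≤ η / (R + 1) * R := by
            gcongr
            exact (min_le_right _ _).trans (min_le_left _ _)
        _ < η / (R + 1) * (R + 1) := by gcongr; linarith
        _ = η := by field_simp
    · calc _ ≤ ε / 2 / (C + 1) * (C + 1) := by
            gcongr
            · exact (min_le_right _ _).trans (min_le_right _ _)
            · linarith
        _ = ε / 2 := by field_simp
  set δ := 1 - τ with hδ
  have hδ0 : 0 < δ := by linarith
  set U : Set E := (fun x => δ • x) ⁻¹' interior K with hU
  have hUo : IsOpen U := isOpen_interior.preimage (continuous_const_smul δ)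
  have hKU : K ⊆ U := by
    intro x hx
    have := hKc.combo_interior_self_mem_interior h0 hx hτ0 hδ0.le (by linarith)
    simpa [hU] using this
  obtain ⟨χ, hχ0, hχ1, -⟩ := exists_contMDiffMap_zero_one_nhds_of_isClosed 𝓘(ℝ, E) (n := 1)
    hUo.isClosed_compl hK.isClosed (Set.disjoint_compl_left_iff_subset.2 hKU)
  rw [eventually_nhdsSet_iff_forall] at hχ0 hχ1
  have hχ : ContDiff ℝ 1 χ := χ.contMDiff.contDiff
  have hfat : ∀ x ∈ U, ContDiffAt ℝ 1 (fun x => f (δ • x)) x := fun x hx =>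
    (hf.contDiffAt (mem_interior_iff_mem_nhds.1 hx)).comp x
      (contDiff_const_smul δ).contDiffAt
  refine ⟨fun x => χ x * f (δ • x), ?_, ?_, ?_⟩
  · rw [contDiff_iff_contDiffAt]
    intro x
    by_cases hx : x ∈ U
    · exact hχ.contDiffAt.mul (hfat x hx)
    · refine (contDiffAt_const (c := (0 : ℝ))).congr_of_eventuallyEq ?_
      filter_upwards [hχ0 x hx] with y hy
      rw [hy, zero_mul]
  · refine HasCompactSupport.intro (K := δ⁻¹ • K) (hK.smul _) fun x hx => ?_
    have : x ∉ U := fun hxU => hx <| by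
      rw [Set.mem_inv_smul_set_iff₀ hδ0.ne']
      exact interior_subset hxU
    rw [(hχ0 x this).self_of_nhds, zero_mul]
  · intro x hx
    have hxU := hKU hx
    have hδx : δ • x ∈ K := interior_subset hxU
    have h1 : (fun x => χ x * f (δ • x)) =ᶠ[𝓝 x] fun x => f (δ • x) := by
      filter_upwards [hχ1 x hx] with y hy
      rw [hy, one_mul]
    have h2 : HasFDerivAt (fun x => f (δ • x)) (δ • fderivWithin ℝ f K (δ • x)) x := by
      have hn : K ∈ 𝓝 (δ • x) := mem_interior_iff_mem_nhds.1 hxU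
      have h3 : HasFDerivAt f (fderivWithin ℝ f K (δ • x)) (δ • x) :=
        ((hf.differentiableOn (by simp)) _ hδx).hasFDerivWithinAt.hasFDerivAt hn
      have h4 := h3.comp x ((hasFDerivAt_id x).const_smul δ)
      refine h4.congr_fderiv ?_
      ext y
      simp
    rw [h1.fderiv_eq, h2.fderiv]
    have h5 : dist (fderivWithin ℝ f K x) (fderivWithin ℝ f K (δ • x)) < ε / 2 := by
      refine hη' x hx _ hδx ?_
      have : x - δ • x = τ • x := by rw [hδ]; module
      rw [dist_eq_norm, this, norm_smul, Real.norm_of_nonneg hτ0.le]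
      exact (mul_le_mul_of_nonneg_left (hR x hx) hτ0.le).trans_lt hτR
    have h6 : fderivWithin ℝ f K x - δ • fderivWithin ℝ f K (δ • x) =
        (fderivWithin ℝ f K x - fderivWithin ℝ f K (δ • x)) + τ • fderivWithin ℝ f K (δ • x) := by
      rw [hδ]; module
    rw [h6]
    refine (norm_add_le _ _).trans ?_
    rw [norm_smul, Real.norm_of_nonneg hτ0.le, ← dist_eq_norm]
    nlinarith [mul_le_mul_of_nonneg_left (hC _ hδx) hτ0.le]

end Extension

/-! ### Deterministic approximation in C¹ -/

section Density

variable {E : Type*} [NormedAddCommGroup E] [InnerProductSpace ℝ E]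

theorem hasFDerivAt_ridge {σ : ℝ → ℝ} (hσ : ContDiff ℝ 1 σ) (p : E × ℝ) (x : E) :
    HasFDerivAt (fun x => σ (inner ℝ p.1 x + p.2))
      (deriv σ (inner ℝ p.1 x + p.2) • innerSL ℝ p.1) x := by
  have h1 : HasDerivAt σ (deriv σ (inner ℝ p.1 x + p.2)) (inner ℝ p.1 x + p.2) :=
    (hσ.differentiable (by simp) _).hasDerivAt
  have h2 : HasFDerivAt (fun x => inner ℝ p.1 x + p.2) (innerSL ℝ p.1) x :=
    ((innerSL ℝ p.1).hasFDerivAt (x := x)).add_const p.2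
  exact h1.comp_hasFDerivAt x h2

/-- The gradients of single-layer networks approximate the gradient of any `C¹` function on a
compact convex body. -/
theorem exists_network_fderiv_near [FiniteDimensional ℝ E] {K : Set E} (hK : IsCompact K)
    (hKc : Convex ℝ K) (h0 : (0 : E) ∈ interior K) {f : E → ℝ} (hf : ContDiffOn ℝ 1 f K)
    {σ : ℝ → ℝ} (hσ : ContDiff ℝ 1 σ) (hi : Integrable (deriv σ)) (hne : deriv σ ≠ 0)
    {ε : ℝ} (hε : 0 < ε) :
    ∃ c : E × ℝ →₀ ℝ, ∀ x ∈ K, ‖fderivWithin ℝ f K x -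
      ∑ p ∈ c.support, c p • deriv σ (inner ℝ p.1 x + p.2) • innerSL ℝ p.1‖ < ε := by
  borelize E
  have hσ' : Continuous (deriv σ) := hσ.continuous_deriv (by simp)
  let s : C(ℝ, ℂ) := ⟨fun t => Complex.ofReal (deriv σ t), Complex.continuous_ofReal.comp hσ'⟩
  have hs0 : s ≠ 0 := fun h => hne <| by
    ext t
    simpa [s] using congrArg (fun g : C(ℝ, ℂ) => g t) h
  obtain ⟨h, hh, hhc, hfh⟩ := exists_contDiff_hasCompactSupport_fderiv_near hK hKc h0 hf
    (ε := ε / 3) (by positivity)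
  obtain ⟨F, hF⟩ := exists_schwartzMap_fderiv_near (h := fun x => (h x : ℂ))
    (Complex.ofRealCLM.contDiff.comp hh) (hhc.comp_left Complex.ofReal_zero) (ε := ε / 3)
    (by positivity)
  obtain ⟨S, c, hS⟩ := F.exists_fderiv_near hK s hi.ofReal hs0 (ε := ε / 3) (by positivity)
  -- The target and the ridge fields are real, and taking real parts does not increase the operator
  -- norm.
  let c' : E × ℝ →₀ ℝ := ∑ p ∈ S, Finsupp.single p (c p).re
  refine ⟨c', fun x hx => ?_⟩
  have hsum : ∑ p ∈ c'.support, c' p • deriv σ (inner ℝ p.1 x + p.2) • innerSL ℝ p.1 =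
      ∑ p ∈ S, (c p).re • deriv σ (inner ℝ p.1 x + p.2) • innerSL ℝ p.1 := by
    change c'.sum (fun p w => w • deriv σ (inner ℝ p.1 x + p.2) • innerSL ℝ p.1) = _
    rw [← Finsupp.sum_finsetSum_index (by simp) (fun p a b => add_smul a b _)]
    simp
  have hre : ∀ A : E →L[ℝ] ℂ, ‖Complex.reCLM.comp A‖ ≤ ‖A‖ := fun A => by
    simpa using Complex.reCLM.opNorm_comp_le A
  have hdh : fderiv ℝ (fun x => (h x : ℂ)) x = Complex.ofRealCLM.comp (fderiv ℝ h x) :=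
    ((Complex.ofRealCLM.hasFDerivAt).comp x
      (hh.differentiable (by simp) x).hasFDerivAt).fderiv
  have h1 := (hre _).trans (hF x)
  have h2 := (hre _).trans_lt (hS x hx)
  have e1 : Complex.reCLM.comp (fderiv ℝ F x - fderiv ℝ (fun x => (h x : ℂ)) x) =
      Complex.reCLM.comp (fderiv ℝ F x) - fderiv ℝ h x := by
    rw [hdh]
    ext y
    simp
  have e2 : Complex.reCLM.comp (fderiv ℝ F x -
      ∑ p ∈ S, c p • s (inner ℝ p.1 x + p.2) • complexInnerSL E p.1) =
      Complex.reCLM.comp (fderiv ℝ F x) -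
      ∑ p ∈ S, (c p).re • deriv σ (inner ℝ p.1 x + p.2) • innerSL ℝ p.1 := by
    ext y
    simp [s, complexInnerSL_apply, ← Complex.ofReal_mul]
  rw [e1, norm_sub_rev] at h1
  rw [e2] at h2
  rw [hsum]
  calc _ ≤ _ := norm_sub_le_norm_sub_add_norm_sub _ (fderiv ℝ h x) _
    _ ≤ _ := add_le_add_right (norm_sub_le_norm_sub_add_norm_sub _
        (Complex.reCLM.comp (fderiv ℝ F x)) _) _
    _ < ε := by linarith [hfh x hx]

/-- Single-layer networks approximate any `C¹` function on a compact convex body in the `C¹`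
sense. -/
theorem exists_network_near [FiniteDimensional ℝ E] {K : Set E} (hK : IsCompact K)
    (hKc : Convex ℝ K) (h0 : (0 : E) ∈ interior K) {f : E → ℝ} (hf : ContDiffOn ℝ 1 f K)
    {σ : ℝ → ℝ} (hσ : ContDiff ℝ 1 σ) (hi : Integrable (deriv σ)) (hne : deriv σ ≠ 0)
    {ε : ℝ} (hε : 0 < ε) :
    ∃ c : E × ℝ →₀ ℝ, ∀ x ∈ K,
      ‖f x - ∑ p ∈ c.support, c p * σ (inner ℝ p.1 x + p.2)‖ < ε ∧
      ‖fderivWithin ℝ f K x -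
        ∑ p ∈ c.support, c p • deriv σ (inner ℝ p.1 x + p.2) • innerSL ℝ p.1‖ < ε := by
  obtain ⟨R, hR⟩ := hK.isBounded.exists_norm_le
  have h0K := interior_subset h0
  have hR0 : 0 ≤ R := (norm_nonneg _).trans (hR 0 h0K)
  -- A neuron with zero inner weight is the constant σ b₀; it corrects the value at 0 without
  -- changing the gradient.
  obtain ⟨b₀, hb₀⟩ : ∃ b, σ b ≠ 0 := by
    by_contra! h
    apply hne
    rw [show σ = fun _ => 0 from funext h]
    ext t
    simp
  obtain ⟨c, hc⟩ := exists_network_fderiv_near hK hKc h0 hf hσ hi hne (ε := ε / (R + 1))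
    (by positivity)
  let g : E → ℝ := fun x => ∑ p ∈ c.support, c p * σ (inner ℝ p.1 x + p.2)
  let k := f 0 - g 0
  let c' := c + Finsupp.single ((0 : E), b₀) (k / σ b₀)
  have hval : ∀ x, ∑ p ∈ c'.support, c' p * σ (inner ℝ p.1 x + p.2) = g x + k := by
    intro x
    change c'.sum (fun p w => w * σ (inner ℝ p.1 x + p.2)) = _
    rw [Finsupp.sum_add_index' (by simp) (fun p a b => add_mul a b _), Finsupp.sum_single_index
      (by simp)]
    simp [hb₀, g, Finsupp.sum]
  have hder : ∀ x, ∑ p ∈ c'.support, c' p • deriv σ (inner ℝ p.1 x + p.2) • innerSL ℝ p.1 =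
      ∑ p ∈ c.support, c p • deriv σ (inner ℝ p.1 x + p.2) • innerSL ℝ p.1 := by
    intro x
    change c'.sum (fun p w => w • deriv σ (inner ℝ p.1 x + p.2) • innerSL ℝ p.1) = _
    rw [Finsupp.sum_add_index' (by simp) (fun p a b => add_smul a b _), Finsupp.sum_single_index
      (by simp)]
    simp [Finsupp.sum]
  refine ⟨c', fun x hx => ?_⟩
  rw [hval, hder]
  constructor
  · have hd : ∀ y ∈ K, HasFDerivWithinAt (fun y => f y - g y) (fderivWithin ℝ f K y -
        ∑ p ∈ c.support, c p • deriv σ (inner ℝ p.1 y + p.2) • innerSL ℝ p.1) K y := by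
      intro y hy
      refine ((hf.differentiableOn (by simp)) y hy).hasFDerivWithinAt.sub
        (HasFDerivAt.hasFDerivWithinAt (HasFDerivAt.fun_sum fun p _ => ?_))
      exact (hasFDerivAt_ridge hσ p y).const_mul (c p)
    have h1 := hKc.norm_image_sub_le_of_norm_hasFDerivWithin_le hd (fun y hy => (hc y hy).le) h0K hx
    have h2 : f x - (g x + k) = f x - g x - (f 0 - g 0) := by simp only [k]; ring
    rw [h2]
    refine h1.trans_lt ?_
    rw [sub_zero]
    calc _ ≤ ε / (R + 1) * R := by gcongr; exact hR x hx
      _ < ε / (R + 1) * (R + 1) := by gcongr; linarith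
      _ = ε := by field_simp
  · exact (hc x hx).trans_le (div_le_self hε.le (by linarith))

end Density

/-! ### Stability in the parameters and hitting times -/

/-- A jointly continuous family depends on its parameter uniformly over compact sets. -/
theorem IsCompact.eventually_forall_norm_sub_lt {Q X G : Type*} [TopologicalSpace Q]
    [TopologicalSpace X] [SeminormedAddCommGroup G] {K : Set X} (hK : IsCompact K)
    {Φ : Q → X → G} (hΦ : Continuous fun z : Q × X => Φ z.1 z.2) (q₀ : Q) {ε : ℝ} (hε : 0 < ε) :
    ∀ᶠ q in 𝓝 q₀, ∀ x ∈ K, ‖Φ q₀ x - Φ q x‖ < ε := by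
  refine hK.eventually_forall_of_forall_eventually fun y _ => ?_
  have hc : Continuous fun z : Q × X => ‖Φ q₀ z.2 - Φ z.1 z.2‖ :=
    ((hΦ.comp (by fun_prop : Continuous fun z : Q × X => (q₀, z.2))).sub hΦ).norm
  exact hc.continuousAt.eventually_lt continuousAt_const (by simpa using hε)

section Probability

variable {Ω S : Type*} [MeasurableSpace Ω] [MeasurableSpace S]
  {P : Measure Ω} [IsProbabilityMeasure P]

/-- An i.i.d. sequence almost surely visits every set of positive probability. -/
theorem ae_exists_mem_of_iIndepFun {X : ℕ → Ω → S} (hX : ∀ j, Measurable (X j))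
    (hindep : iIndepFun X P) (hident : ∀ i j, IdentDistrib (X i) (X j) P P) {U : Set S}
    (hU : MeasurableSet U) (hpos : P.map (X 0) U ≠ 0) : ∀ᵐ ω ∂P, ∃ j, X j ω ∈ U := by
  set q := P (X 0 ⁻¹' Uᶜ) with hq
  have hq1 : q < 1 := by
    rw [hq, Set.preimage_compl, prob_compl_eq_one_sub (hX 0 hU)]
    rw [Measure.map_apply (hX 0) hU] at hpos
    exact ENNReal.sub_lt_self ENNReal.one_ne_top one_ne_zero hpos
  -- By independence, N successive misses have probability q ^ N, which tends to 0.
  have hle : ∀ N : ℕ, P {ω | ¬ ∃ j, X j ω ∈ U} ≤ q ^ N := by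
    intro N
    have h := hindep.measure_inter_preimage_eq_mul (Finset.range N) (sets := fun _ => Uᶜ)
      fun _ _ => hU.compl
    have h2 : ∀ i ∈ Finset.range N, P (X i ⁻¹' Uᶜ) = q := fun i _ =>
      (hident i 0).measure_mem_eq hU.compl
    rw [Finset.prod_congr rfl h2, Finset.prod_const, Finset.card_range] at h
    rw [← h]
    refine measure_mono fun ω hω => ?_
    simp only [Set.mem_iInter]
    exact fun i _ hi => hω ⟨i, hi⟩
  exact le_antisymm (ge_of_tendsto' (ENNReal.tendsto_pow_atTop_nhds_zero_of_lt_one hq1) hle)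
    zero_le

/-- The probability that the first `N` terms of an i.i.d. sequence visit each of finitely many sets
of positive probability tends to `1`. -/
theorem exists_lt_measureReal_forall_exists_mem {ι : Type*} [Finite ι] {X : ℕ → Ω → S}
    (hX : ∀ j, Measurable (X j)) (hindep : iIndepFun X P)
    (hident : ∀ i j, IdentDistrib (X i) (X j) P P) {U : ι → Set S}
    (hU : ∀ i, MeasurableSet (U i)) (hpos : ∀ i, P.map (X 0) (U i) ≠ 0) {α : ℝ} (hα : α < 1) :
    ∃ N : ℕ, 0 < N ∧ α < P.real {ω | ∀ i, ∃ j : Fin N, X j ω ∈ U i} := by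
  let A : ℕ → Set Ω := fun N => {ω | ∀ i, ∃ j : Fin N, X j ω ∈ U i}
  have hA : Monotone A := fun N M hNM ω hω i =>
    let ⟨j, hj⟩ := hω i
    ⟨Fin.castLE hNM j, hj⟩
  have hae : ∀ᵐ ω ∂P, ω ∈ ⋃ N, A N := by
    have : ∀ᵐ ω ∂P, ∀ i, ∃ j, X j ω ∈ U i := ae_all_iff.2 fun i =>
      ae_exists_mem_of_iIndepFun hX hindep hident (hU i) (hpos i)
    filter_upwards [this] with ω hω
    choose j hj using hω
    obtain ⟨N, hN⟩ := (Set.finite_range j).bddAbove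
    exact Set.mem_iUnion.2 ⟨N + 1, fun i =>
      ⟨⟨j i, Nat.lt_succ_of_le (hN ⟨i, rfl⟩)⟩, hj i⟩⟩
  have hlim : Tendsto (fun N => P.real (A N)) atTop (𝓝 1) := by
    have h := tendsto_measure_iUnion_atTop (μ := P) hA
    rw [measure_congr (eventuallyEq_univ.2 hae : (⋃ N, A N) =ᵐ[P] Set.univ), measure_univ] at h
    exact (ENNReal.tendsto_toReal ENNReal.one_ne_top).comp h
  obtain ⟨N, hN, hN0⟩ := ((hlim.eventually_const_lt hα).and (eventually_gt_atTop 0)).exists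
  exact ⟨N, hN0, hN⟩

end Probability

/-! ### Geometry of the cube -/

section Hypercube

variable {n : ℕ}

theorem isCompact_hypercube : IsCompact (hypercube n) := by
  have : hypercube n = (EuclideanSpace.equiv (Fin n) ℝ).toHomeomorph ⁻¹'
      Set.univ.pi fun _ => Set.Icc (-1 : ℝ) 1 := by
    ext x
    simp only [hypercube, Set.mem_preimage, Set.mem_univ_pi]
    rfl
  rw [this, Homeomorph.isCompact_preimage]
  exact isCompact_univ_pi fun _ => isCompact_Icc

theorem convex_hypercube : Convex ℝ (hypercube n) := fun x hx y hy a b ha hb hab i => by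
  simpa using convex_Icc (-1 : ℝ) 1 (hx i) (hy i) ha hb hab

theorem zero_mem_interior_hypercube : (0 : EuclideanSpace ℝ (Fin n)) ∈ interior (hypercube n) := by
  refine mem_interior_iff_mem_nhds.2 (Filter.mem_of_superset (Metric.ball_mem_nhds 0 one_pos) ?_)
  intro x hx i
  have h1 : ‖x i‖ ≤ ‖x‖ := PiLp.norm_apply_le x i
  rw [mem_ball_zero_iff] at hx
  exact abs_le.1 (h1.trans hx.le)

theorem c1Norm_le {h : EuclideanSpace ℝ (Fin n) → ℝ} {A : ℝ}
    (h1 : ∀ x ∈ hypercube n, ‖h x‖ ≤ A)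
    (h2 : ∀ x ∈ hypercube n, ‖fderivWithin ℝ h (hypercube n) x‖ ≤ A) :
    c1Norm h ≤ ENNReal.ofReal A + ENNReal.ofReal A := by
  refine add_le_add (iSup₂_le fun x hx => ?_) (iSup₂_le fun x hx => ?_) <;>
  rw [← ofReal_norm]
  · exact ENNReal.ofReal_le_ofReal (h1 x hx)
  · exact ENNReal.ofReal_le_ofReal (h2 x hx)

end Hypercube

/-! ### The random network -/

theorem mainTheorem5 (n : ℕ)
    (f : EuclideanSpace ℝ (Fin n) → ℝ) (hf : ContDiffOn ℝ 1 f (hypercube n))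
    (σ : ℝ → ℝ) (hσ : IsFiniteOfOrder 1 σ)
    {Ω : Type*} [MeasurableSpace Ω] (P : Measure Ω) [IsProbabilityMeasure P]
    (v : ℕ → Ω → EuclideanSpace ℝ (Fin n)) (b : ℕ → Ω → ℝ)
    (hv : ∀ j, Measurable (v j)) (hb : ∀ j, Measurable (b j))
    (hindep : iIndepFun (fun j ω => (v j ω, b j ω)) P)
    (hident : ∀ i j, IdentDistrib (fun ω => (v i ω, b i ω)) (fun ω => (v j ω, b j ω)) P P)
    (hsupp : ∀ j, (P.map (fun ω => (v j ω, b j ω))).support = Set.univ)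
    (α : ℝ) (hα : α ∈ Set.Ioo (0 : ℝ) 1) (ε : ℝ) (hε : 0 < ε) :
    ∃ N : ℕ, 0 < N ∧
      α < P.real {ω | ∃ w : Fin N → ℝ,
        c1Norm (fun x => f x - network σ (fun j => v j ω) (fun j => b j ω) w x)
          < ENNReal.ofReal ε} := by
  obtain ⟨hσ1, hσ2, hσ3⟩ := hσ
  simp only [iteratedDeriv_one] at hσ2 hσ3
  have hσ1 : ContDiff ℝ 1 σ := by exact_mod_cast hσ1
  have hσ' : Continuous (deriv σ) := hσ1.continuous_deriv (by simp)
  have hi : Integrable (deriv σ) := ⟨hσ'.aestronglyMeasurable, hσ3⟩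
  have hne : deriv σ ≠ 0 := by
    intro h
    simp [h] at hσ2
  -- Approximation and perturbation each cost ε/6, in values and in derivatives; the two suprema
  -- then total at most 2ε/3, which restores strictness.
  obtain ⟨c, hc⟩ := exists_network_near isCompact_hypercube convex_hypercube
    zero_mem_interior_hypercube hf hσ1 hi hne (ε := ε / 6) (by positivity)
  let I := c.support
  let Φ : (I → EuclideanSpace ℝ (Fin n) × ℝ) → EuclideanSpace ℝ (Fin n) → ℝ := fun q x =>
    ∑ p : I, c p * σ (inner ℝ (q p).1 x + (q p).2)
  let Ψ : (I → EuclideanSpace ℝ (Fin n) × ℝ) → EuclideanSpace ℝ (Fin n) →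
      EuclideanSpace ℝ (Fin n) →L[ℝ] ℝ := fun q x =>
    ∑ p : I, c p • deriv σ (inner ℝ (q p).1 x + (q p).2) • innerSL ℝ (q p).1
  have hσc := hσ1.continuous
  have hΦ := isCompact_hypercube.eventually_forall_norm_sub_lt (K := hypercube n) (Φ := Φ)
    (by fun_prop) (fun p => p) (ε := ε / 6) (by positivity)
  have hΨ := isCompact_hypercube.eventually_forall_norm_sub_lt (K := hypercube n) (Φ := Ψ)
    (by fun_prop) (fun p => p) (ε := ε / 6) (by positivity)
  obtain ⟨r, hr, hball⟩ := Metric.eventually_nhds_iff.1 (hΦ.and hΨ)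
  obtain ⟨N, hN, hα'⟩ := exists_lt_measureReal_forall_exists_mem
    (fun j => (hv j).prodMk (hb j)) hindep hident
    (U := fun p : I => Metric.ball (p : EuclideanSpace ℝ (Fin n) × ℝ) r)
    (fun p => measurableSet_ball)
    (fun p => ((Measure.mem_support_iff_forall (p : EuclideanSpace ℝ (Fin n) × ℝ)).1
      (by rw [hsupp 0]; trivial) _ (Metric.ball_mem_nhds _ hr)).ne') hα.2
  -- Monotonicity needs no measurability of the event that good weights exist.
  refine ⟨N, hN, hα'.trans_le (measureReal_mono fun ω hω => ?_)⟩
  choose j hj using hω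
  let q : I → EuclideanSpace ℝ (Fin n) × ℝ := fun p => (v (j p) ω, b (j p) ω)
  obtain ⟨hq1, hq2⟩ := hball (y := q) ((dist_pi_lt_iff hr).2 hj)
  -- One random neuron may serve several p, whose coefficients add up; a neuron serving none gets
  -- weight 0.
  refine ⟨fun k => ∑ p : I with j p = k, c p, ?_⟩
  have hnet : network σ (fun j : Fin N => v j ω) (fun j => b j ω)
      (fun k => ∑ p : I with j p = k, c p) = Φ q := by
    ext x
    simp only [network, Φ, q]
    rw [← Finset.sum_fiberwise Finset.univ j]
    refine Finset.sum_congr rfl fun k _ => ?_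
    rw [Finset.sum_mul]
    refine Finset.sum_congr rfl fun p hp => ?_
    rw [(Finset.mem_filter.1 hp).2]
  rw [hnet]
  have hder : ∀ x ∈ hypercube n, fderivWithin ℝ (fun x => f x - Φ q x) (hypercube n) x =
      fderivWithin ℝ f (hypercube n) x - Ψ q x := by
    intro x hx
    have hd : HasFDerivAt (Φ q) (Ψ q x) x :=
      HasFDerivAt.fun_sum fun p _ => (hasFDerivAt_ridge hσ1 (q p) x).const_mul (c p)
    exact (((hf.differentiableOn (by simp)) x hx).hasFDerivWithinAt.sub
      hd.hasFDerivWithinAt).fderivWithin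
      (uniqueDiffOn_convex convex_hypercube ⟨0, zero_mem_interior_hypercube⟩ x hx)
  have hΦ0 : ∀ x, ∑ p ∈ c.support, c p * σ (inner ℝ p.1 x + p.2) = Φ (fun p => p) x := fun x =>
    (Finset.sum_coe_sort c.support fun p => c p * σ (inner ℝ p.1 x + p.2)).symm
  have hΨ0 : ∀ x, ∑ p ∈ c.support, c p • deriv σ (inner ℝ p.1 x + p.2) • innerSL ℝ p.1 =
      Ψ (fun p => p) x := fun x =>
    (Finset.sum_coe_sort c.support
      fun p => c p • deriv σ (inner ℝ p.1 x + p.2) • innerSL ℝ p.1).symm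
  refine (c1Norm_le (A := ε / 3) (fun x hx => ?_) fun x hx => ?_).trans_lt ?_
  · have h1 := (hc x hx).1
    rw [hΦ0] at h1
    have := norm_sub_le_norm_sub_add_norm_sub (f x) (Φ (fun p => p) x) (Φ q x)
    linarith [hq1 x hx]
  · have h1 := (hc x hx).2
    rw [hΨ0] at h1
    rw [hder x hx]
    have := norm_sub_le_norm_sub_add_norm_sub (fderivWithin ℝ f (hypercube n) x)
      (Ψ (fun p => p) x) (Ψ q x)
    linarith [hq2 x hx]
  · rw [← ENNReal.ofReal_add (by positivity) (by positivity)]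
    exact (ENNReal.ofReal_lt_ofReal_iff hε).2 (by linarith)
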